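/- **Definitions.** For a finite graph $G=(V,E)$ and a map $\mathbf p:V\to\mathbb R^3$ (a framework $G(\mathbf p)$), the row of a pair $\{u,w\}$ has $\mathbf p_u-\mathbf p_w$ in the three columns of $u$, $\mathbf p_w-\mathbf p_u$ in the three columns of $w$, and zeros elsewhere; the rigidity matrix of $G(\mathbf p)$ consists of the rows of the edges of $G$. $G(\mathbf p)$ is *generic* if this matrix has maximum rank over all frameworks of $G$ in $\mathbb R^3$. A pair is *implied in* $G(\mathbf p)$ if its row is linearly dependent on the rows of the rigidity matrix of $G(\mathbf p)$; a pair of distinct non-adjacent vertices is an *implied non-edge* of $G$ if it is implied in every generic framework of $G$. An *infinitesimal motion* of $G(\mathbf p)$ is $v:V\to\mathbb R^3$ with $\langle \mathbf p_u-\mathbf p_w,v_u-v_w\rangle=0$ for all $\{u,w\}\in E$; under $v$ a pair $\{u,w\}$ is expanding, contracting or unflexed according as $\langle \mathbf p_u-\mathbf p_w,v_u-v_w\rangle$ is positive, negative or zero. A *roof* is $K_5$ on vertices $a,b,a',b',c$ with the two non-adjacent edges $\{a,b\}$ and $\{a',b'\}$ (its *hinge non-edges*) deleted; $c$ is its apex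 and the 4-cycle $a,a',b,b'$ its base. A roof in $\mathbb R^3$ is *convex* (respectively *pointed pseudo-triangular*) if its base lies strictly on one side of some plane through $c$ and the central projection of the base from $c$ to a parallel plane on that side is a four-gon with no three vertices collinear whose diagonals cross (respectively, with no three vertices collinear and one vertex inside the triangle of the other three). The *ring of roofs* $\mathscr R_k$ has vertices $a_i,b_i,c_i$ ($i\in\mathbb Z/k$) and is the union of the roofs on $a_i,b_i,a_{i+1},b_{i+1},c_i$ with apex $c_i$ and hinge non-edges $\{a_i,b_i\}$, $\{a_{i+1},b_{i+1}\}$. **Lemma.** Let $k\ge 7$. 1. Every convex roof is expansive-contractive: in each infinitesimal motion of the roof, either hinge non-edge expands if and only if the other contracts. Every pointed pseudo-triangular roof is expansive-expansive: in each infinitesimal motion of the roof, one hinge non-edge expands if and only if the other expands, and contracts if and only if the other contracts. 2. Let $\mathscr R_k(\mathbf p)$ be a ring framework in which one roof is convex and the other $k-1$ roofs are pointed pseudo-triangular. Then every hinge non-edge is unflexed by every infinitesimal motion of $\mathscr R_k(\mathbf p)$, and is implied in $\mathscr R_k(\mathbf p)$. 3. For each $j\in\mathbb Z/k$, the set of all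 $\mathbf p\in\mathbb R^{3\cdot 3k}$ such that in $\mathscr R_k(\mathbf p)$ the $j$-th roof is convex and all the others are pointed pseudo-triangular is open and contains a generic framework. 4. Consequently every hinge non-edge $\{a_i,b_i\}$ is an implied non-edge of the graph $\mathscr R_k$. -/

import Mathlib

/-- Euclidean three-space. -/
abbrev E3 : Type := EuclideanSpace ℝ (Fin 3)

section Frameworks

variable {V : Type*}

/-- Half the first-order rate of change of `|p u - p w|²` when the points of the framework `p` move
with velocities `v`: positive means that the pair expands, negative that it contracts. -/
noncomputable def pairRate (p v : V → E3) (u w : V) : ℝ :=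
  inner ℝ (p u - p w) (v u - v w)

/-- `v` is an infinitesimal motion of the framework `G(p)`: all edge lengths are preserved to first
order. -/
def IsInfinitesimalMotion (G : SimpleGraph V) (p v : V → E3) : Prop :=
  ∀ u w, G.Adj u w → pairRate p v u w = 0

/-- The row of the rigidity matrix that belongs to the pair `{u, w}`: it carries `p u - p w` in the
three columns of `u`, `p w - p u` in the three columns of `w`, and zeros elsewhere. -/
def rigidityRow [DecidableEq V] (p : V → E3) (u w : V) : V × Fin 3 → ℝ := fun x =>
  (if x.1 = u then p u x.2 - p w x.2 else 0) + (if x.1 = w then p w x.2 - p u x.2 else 0)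

theorem rigidityRow_comm [DecidableEq V] (p : V → E3) (u w : V) :
    rigidityRow p u w = rigidityRow p w u := by
  funext x
  exact add_comm _ _

/-- The rigidity matrix of the framework `G(p)`: one row per edge, one column per coordinate of a
vertex. -/
def rigidityMatrix [DecidableEq V] (G : SimpleGraph V) (p : V → E3) :
    Matrix G.edgeSet (V × Fin 3) ℝ :=
  Matrix.of fun e => Sym2.lift ⟨rigidityRow p, rigidityRow_comm p⟩ e.1

/-- `G(p)` is generic: its rigidity matrix has maximum rank over all frameworks of `G`. -/
def IsGenericFramework [Fintype V] [DecidableEq V] (G : SimpleGraph V) (p : V → E3) : Prop :=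
  ∀ q : V → E3, (rigidityMatrix G q).rank ≤ (rigidityMatrix G p).rank

/-- The pair `{u, w}` is implied in the framework `G(p)`: its row is linearly dependent on the rows
of the rigidity matrix of `G(p)`. -/
def IsImpliedAt [DecidableEq V] (G : SimpleGraph V) (p : V → E3) (u w : V) : Prop :=
  rigidityRow p u w ∈ Submodule.span ℝ (Set.range (rigidityMatrix G p).row)

/-- `{u, w}` is an implied non-edge of the graph `G`: it is a non-edge whose row is linearly
dependent on the rows of every generic rigidity matrix of `G`. -/
def IsImpliedNonEdge [Fintype V] [DecidableEq V] (G : SimpleGraph V) (u w : V) : Prop :=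
  u ≠ w ∧ ¬ G.Adj u w ∧ ∀ p : V → E3, IsGenericFramework G p → IsImpliedAt G p u w

end Frameworks

/-! ### Planar four-gons (four coplanar points of space, in cyclic order) -/

/-- No three of the four points are collinear. -/
def NoThreeCollinear (x : Fin 4 → E3) : Prop :=
  ∀ i : Fin 4, AffineIndependent ℝ (fun j : {j : Fin 4 // j ≠ i} => x j)

/-- The planar four-gon `x 0, x 1, x 2, x 3` is strictly convex: no three vertices are collinear and
its two diagonals cross. -/
def IsStrictlyConvexQuad (x : Fin 4 → E3) : Prop :=
  NoThreeCollinear x ∧ (openSegment ℝ (x 0) (x 2) ∩ openSegment ℝ (x 1) (x 3)).Nonempty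

/-- The planar four-gon `x` is a (strictly) pointed pseudo-triangle: no three vertices are collinear
and one vertex, the reflex one, lies in the triangle of the other three, which are the corners. -/
def IsPseudoTriangleQuad (x : Fin 4 → E3) : Prop :=
  NoThreeCollinear x ∧ ∃ i : Fin 4, x i ∈ convexHull ℝ (x '' {i}ᶜ)

/-- The central projection of the points `q` from the apex `c` to the plane
`{y | ⟪n, y - c⟫ = 1}`. -/
noncomputable def coneSection (c : E3) (q : Fin 4 → E3) (n : E3) : Fin 4 → E3 :=
  fun i => c + (inner ℝ n (q i - c))⁻¹ • (q i - c)

/-! ### Roofs -/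

/-- The roof: the complete graph on five vertices with the two non-adjacent edges `{0, 1}` and
`{2, 3}`, the hinge non-edges, deleted. The vertex `4` is the apex. -/
def roofGraph : SimpleGraph (Fin 5) :=
  (⊤ : SimpleGraph (Fin 5)).deleteEdges {s(0, 1), s(2, 3)}

/-- The base of a roof: the four-cycle `0, 2, 1, 3`, whose diagonals are the hinge non-edges. -/
def roofBase (x : Fin 5 → E3) : Fin 4 → E3 := ![x 0, x 2, x 1, x 3]

/-- A convex roof: the base lies, seen from the apex, in an open half-space, and the cone over it
from the apex has a strictly convex four-gon as a plane section. -/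
def IsConvexRoof (x : Fin 5 → E3) : Prop :=
  ∃ n : E3, (∀ i, 0 < inner ℝ n (roofBase x i - x 4)) ∧
    IsStrictlyConvexQuad (coneSection (x 4) (roofBase x) n)

/-- A pointed pseudo-triangular roof: the same with a pointed pseudo-triangle as the section. -/
def IsPseudoTriangularRoof (x : Fin 5 → E3) : Prop :=
  ∃ n : E3, (∀ i, 0 < inner ℝ n (roofBase x i - x 4)) ∧
    IsPseudoTriangleQuad (coneSection (x 4) (roofBase x) n)

/-- In every infinitesimal motion of the roof, one hinge non-edge expands exactly if the other one
contracts. -/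
def IsExpansiveContractive (x : Fin 5 → E3) : Prop :=
  ∀ v : Fin 5 → E3, IsInfinitesimalMotion roofGraph x v →
    (0 < pairRate x v 0 1 ↔ pairRate x v 2 3 < 0) ∧
    (pairRate x v 0 1 < 0 ↔ 0 < pairRate x v 2 3)

/-- In every infinitesimal motion of the roof, the two hinge non-edges expand together and contract
together. -/
def IsExpansiveExpansive (x : Fin 5 → E3) : Prop :=
  ∀ v : Fin 5 → E3, IsInfinitesimalMotion roofGraph x v →
    (0 < pairRate x v 0 1 ↔ 0 < pairRate x v 2 3) ∧
    (pairRate x v 0 1 < 0 ↔ pairRate x v 2 3 < 0)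

/-! ### Rings of roofs -/

/-- The vertices `a i = (i, 0)`, `b i = (i, 1)` and `c i = (i, 2)` of a ring of `k` roofs. -/
abbrev RingVertex (k : ℕ) : Type := Fin k × Fin 3

/-- First vertex of the `i`-th hinge. -/
def hingeA {k : ℕ} (i : Fin k) : RingVertex k := (i, 0)

/-- Second vertex of the `i`-th hinge. -/
def hingeB {k : ℕ} (i : Fin k) : RingVertex k := (i, 1)

/-- Apex of the `i`-th roof. -/
def roofApex {k : ℕ} (i : Fin k) : RingVertex k := (i, 2)

/-- The vertices of the `i`-th roof: it has the hinges `i` and `i + 1` (cyclically, by `finRotate`)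
and the apex `c i`. -/
def roofVertex {k : ℕ} (i : Fin k) : Fin 5 → RingVertex k :=
  ![hingeA i, hingeB i, hingeA (finRotate k i), hingeB (finRotate k i), roofApex i]

/-- The ring of `k` roofs: the union of the `k` roofs, consecutive ones sharing a hinge. -/
def ringGraph (k : ℕ) : SimpleGraph (RingVertex k) :=
  SimpleGraph.fromRel fun u w => ∃ (i : Fin k) (x y : Fin 5),
    roofGraph.Adj x y ∧ roofVertex i x = u ∧ roofVertex i y = w

/-- In the ring framework `p` the roof `j` is convex and all other roofs are pointed
pseudo-triangular. -/
def IsOneConvexRing {k : ℕ} (j : Fin k) (p : RingVertex k → E3) : Prop :=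
  IsConvexRoof (p ∘ roofVertex j) ∧
    ∀ i : Fin k, i ≠ j → IsPseudoTriangularRoof (p ∘ roofVertex i)

/-! Seen from its apex `c`, the base of a roof gives four vectors `q i - c` in three-space, hence a
linear dependency whose coefficients `a i` are signed 3×3 minors (`baseCoeff`). Once the base lies
in an open half-space, the signs of the `a i` decide the shape of the section: the roof is convex
iff `a 0 * a 2` and `a 1 * a 3` are both positive, and pointed pseudo-triangular iff the product of
all four is negative. These are open conditions.

The same coefficients govern the flexes. The products `a i * a j` are stresses on the base pairs,
balanced by stresses on the edges to the apex. In an infinitesimal motion only the two hinge terms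
survive, and they satisfy `a 0 * a 2 * r + a 1 * a 3 * r' = 0` for the hinge rates `r`, `r'`
(`baseCoeff_mul_pairRate_add_eq_zero`). Hence a convex roof reverses the sign of the hinge rate and
a pseudo-triangular roof preserves it. Once around a ring with exactly one reversal, the sign equals
its own negative, so all hinge rates vanish (`pairRate_hinge_eq_zero`), and by duality the hinges
are implied.

Such rings exist, with hinges on the moment curve and apexes chosen roof by roof. As they form an
open set and generic frameworks are dense, a rank comparison carries implication over to every
generic framework (`isImpliedAt_of_isOpen`). -/

/-! ### The linear dependency of the base vectors. -/

/-- The coefficients, up to scaling, of the linear dependency between the four vectors `q i - c`. -/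
noncomputable def baseCoeff (c : E3) (q : Fin 4 → E3) (i : Fin 4) : ℝ :=
  (-1) ^ (i : ℕ) * (Matrix.of fun k l : Fin 3 => (q (i.succAbove k) - c) l).det

theorem baseCoeff_zero (c : E3) (q : Fin 4 → E3) : baseCoeff c q 0 =
    (Matrix.of fun k l : Fin 3 => (![q 1 - c, q 2 - c, q 3 - c] k) l).det := by
  simp [baseCoeff, Matrix.det_fin_three, Fin.succAbove]

theorem baseCoeff_one (c : E3) (q : Fin 4 → E3) : baseCoeff c q 1 =
    -(Matrix.of fun k l : Fin 3 => (![q 0 - c, q 2 - c, q 3 - c] k) l).det := by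
  simp [baseCoeff, Matrix.det_fin_three, Fin.succAbove]

theorem baseCoeff_two (c : E3) (q : Fin 4 → E3) : baseCoeff c q 2 =
    (Matrix.of fun k l : Fin 3 => (![q 0 - c, q 1 - c, q 3 - c] k) l).det := by
  simp [baseCoeff, Matrix.det_fin_three, Fin.succAbove, Fin.lt_def]

theorem baseCoeff_three (c : E3) (q : Fin 4 → E3) : baseCoeff c q 3 =
    -(Matrix.of fun k l : Fin 3 => (![q 0 - c, q 1 - c, q 2 - c] k) l).det := by
  simp [baseCoeff, Matrix.det_fin_three, Fin.succAbove, Fin.lt_def, pow_succ]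

theorem sum_baseCoeff_smul (c : E3) (q : Fin 4 → E3) :
    ∑ i, baseCoeff c q i • (q i - c) = 0 := by
  rw [Fin.sum_univ_four, baseCoeff_zero, baseCoeff_one, baseCoeff_two, baseCoeff_three]
  ext l
  fin_cases l <;> simp [Matrix.det_fin_three] <;> ring

/-- Uniqueness of the dependency up to scaling, in a cross-multiplied form that survives the
vanishing of some or all minors. -/
theorem mul_baseCoeff_comm {c : E3} {q : Fin 4 → E3} {μ : Fin 4 → ℝ}
    (h : ∑ i, μ i • (q i - c) = 0) (i j : Fin 4) :
    μ i * baseCoeff c q j = μ j * baseCoeff c q i := by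
  have H (l : Fin 3) := congrArg (fun x : E3 => x l) h
  have H0 := H 0
  have H1 := H 1
  have H2 := H 2
  simp only [Fin.sum_univ_four, PiLp.add_apply, PiLp.smul_apply, smul_eq_mul, PiLp.zero_apply]
    at H0 H1 H2
  have e0 := baseCoeff_zero c q
  have e1 := baseCoeff_one c q
  have e2 := baseCoeff_two c q
  have e3 := baseCoeff_three c q
  simp only [Matrix.det_fin_three, Matrix.of_apply, Matrix.cons_val] at e0 e1 e2 e3
  generalize q 0 - c = x0 at *
  generalize q 1 - c = x1 at *
  generalize q 2 - c = x2 at *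
  generalize q 3 - c = x3 at *
  -- Pairing the dependency with the cross product of `a` and `b` kills the terms of those two
  -- vectors and leaves a relation between two minors.
  have cr (a b : E3) := congrArg₂ (· + ·) (congrArg₂ (· + ·)
    (congrArg (fun z => z * (a 1 * b 2 - a 2 * b 1)) H0)
    (congrArg (fun z => z * (a 2 * b 0 - a 0 * b 2)) H1))
    (congrArg (fun z => z * (a 0 * b 1 - a 1 * b 0)) H2)
  simp only [zero_mul, add_zero] at cr
  have h01 : μ 0 * baseCoeff c q 1 = μ 1 * baseCoeff c q 0 := by
    rw [e0, e1]; linear_combination -cr x2 x3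
  have h02 : μ 0 * baseCoeff c q 2 = μ 2 * baseCoeff c q 0 := by
    rw [e0, e2]; linear_combination cr x1 x3
  have h03 : μ 0 * baseCoeff c q 3 = μ 3 * baseCoeff c q 0 := by
    rw [e0, e3]; linear_combination -cr x1 x2
  have h12 : μ 1 * baseCoeff c q 2 = μ 2 * baseCoeff c q 1 := by
    rw [e1, e2]; linear_combination cr x0 x3 * (-1)
  have h13 : μ 1 * baseCoeff c q 3 = μ 3 * baseCoeff c q 1 := by
    rw [e1, e3]; linear_combination cr x0 x2
  have h23 : μ 2 * baseCoeff c q 3 = μ 3 * baseCoeff c q 2 := by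
    rw [e2, e3]; linear_combination cr x0 x1 * (-1)
  fin_cases i <;> fin_cases j <;>
    first | rfl | assumption | (symm; assumption)

theorem exists_smul_sum_eq_zero_of_baseCoeff_eq_zero {c : E3} {q : Fin 4 → E3} {i : Fin 4}
    (h : baseCoeff c q i = 0) :
    ∃ μ : Fin 3 → ℝ, μ ≠ 0 ∧ ∑ k, μ k • (q (i.succAbove k) - c) = 0 := by
  have hd : (Matrix.of fun k l : Fin 3 => (q (i.succAbove k) - c) l).det = 0 := by
    simpa [baseCoeff] using h
  obtain ⟨μ, hμ, h0⟩ := Matrix.exists_vecMul_eq_zero_iff.mpr hd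
  refine ⟨μ, hμ, ?_⟩
  ext l
  have := congrFun h0 l
  simpa [Matrix.vecMul, dotProduct] using this

/-! ### Shapes of plane sections as sign conditions. -/

theorem noThreeCollinear_iff (x : Fin 4 → E3) :
    NoThreeCollinear x ↔ ∀ i : Fin 4, AffineIndependent ℝ (fun k : Fin 3 => x (i.succAbove k)) := by
  refine forall_congr' fun i => ?_
  rw [← affineIndependent_equiv (finSuccAboveEquiv i)]
  rfl

theorem coneSection_sub {c : E3} {q : Fin 4 → E3} {n : E3} (i : Fin 4) :
    coneSection c q n i - c = (inner ℝ n (q i - c) : ℝ)⁻¹ • (q i - c) := by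
  simp [coneSection]

theorem affineIndependent_fin_three {x : Fin 3 → E3} : AffineIndependent ℝ x ↔
    ∀ w : Fin 3 → ℝ, ∑ k, w k = 0 → ∑ k, w k • x k = 0 → w = 0 := by
  rw [affineIndependent_iff]
  constructor
  · intro h w h1 h2
    funext k
    exact h Finset.univ w h1 h2 k (Finset.mem_univ k)
  · intro h s w h1 h2 k hk
    have := congrFun (h (fun k => if k ∈ s then w k else 0) (by simpa using h1)
      (by simpa [ite_smul] using h2)) k
    simpa [hk] using this

/-- Scaling weights by the heights `inner ℝ n (q i - c)` turns linear dependencies of the vectors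
into affine ones of the section points: pairing with `n` shows that the scaled weights sum to zero.
-/
theorem noThreeCollinear_coneSection_iff {c : E3} {q : Fin 4 → E3} {n : E3}
    (hn : ∀ i, 0 < (inner ℝ n (q i - c) : ℝ)) :
    NoThreeCollinear (coneSection c q n) ↔ ∀ i, baseCoeff c q i ≠ 0 := by
  rw [noThreeCollinear_iff]
  refine forall_congr' fun i => ?_
  rw [affineIndependent_fin_three]
  constructor
  · intro h h0
    obtain ⟨μ, hμ, hs⟩ := exists_smul_sum_eq_zero_of_baseCoeff_eq_zero h0
    have hw := h (fun k => μ k * inner ℝ n (q (i.succAbove k) - c)) (by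
      have := congrArg (fun y => (inner ℝ n y : ℝ)) hs
      simpa [inner_sum, inner_smul_right] using this) (by
      have h1 : ∑ k, μ k * (inner ℝ n (q (i.succAbove k) - c) : ℝ) = 0 := by
        have := congrArg (fun y => (inner ℝ n y : ℝ)) hs
        simpa only [inner_sum, inner_smul_right, inner_zero_right] using this
      simp only [coneSection, smul_add, Finset.sum_add_distrib, ← Finset.sum_smul, h1, zero_smul,
        zero_add, smul_smul, mul_assoc, mul_inv_cancel₀ (hn _).ne', mul_one, hs])
    apply hμ
    funext k
    have := congrFun hw k
    simpa [(hn _).ne'] using this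
  · intro h w h1 h2
    have h3 : ∑ k, (w k * (inner ℝ n (q (i.succAbove k) - c) : ℝ)⁻¹) • (q (i.succAbove k) - c)
        = 0 := by
      simpa only [coneSection, smul_add, Finset.sum_add_distrib, ← Finset.sum_smul, h1, zero_smul,
        zero_add, smul_smul] using h2
    have h4 : ∑ j, (i.insertNth 0 (fun k => w k * (inner ℝ n (q (i.succAbove k) - c) : ℝ)⁻¹) :
        Fin 4 → ℝ) j • (q j - c) = 0 := by
      rw [Fin.sum_univ_succAbove _ i]
      simpa using h3
    funext k
    have := mul_baseCoeff_comm h4 (i.succAbove k) i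
    simpa [h, (hn _).ne'] using this

theorem sum_baseCoeff_mul_inner (c : E3) (q : Fin 4 → E3) (n : E3) :
    ∑ i, baseCoeff c q i * (inner ℝ n (q i - c) : ℝ) = 0 := by
  have := congrArg (fun y => (inner ℝ n y : ℝ)) (sum_baseCoeff_smul c q)
  simpa only [inner_sum, inner_smul_right, inner_zero_right] using this

/-- A crossing point of the diagonals is a dependency with sign pattern `+ - + -`, which must be
proportional to `baseCoeff`. -/
theorem isStrictlyConvexQuad_coneSection_iff {c : E3} {q : Fin 4 → E3} {n : E3}
    (hn : ∀ i, 0 < (inner ℝ n (q i - c) : ℝ)) :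
    IsStrictlyConvexQuad (coneSection c q n) ↔
      0 < baseCoeff c q 0 * baseCoeff c q 2 ∧ 0 < baseCoeff c q 1 * baseCoeff c q 3 := by
  rw [IsStrictlyConvexQuad, noThreeCollinear_coneSection_iff hn]
  constructor
  · rintro ⟨hne, y, ⟨s, t, hs, ht, hst, rfl⟩, u, v, hu, hv, huv, he⟩
    have h : ∑ i, (![s * (inner ℝ n (q 0 - c))⁻¹, -(u * (inner ℝ n (q 1 - c))⁻¹),
        t * (inner ℝ n (q 2 - c))⁻¹, -(v * (inner ℝ n (q 3 - c))⁻¹)] : Fin 4 → ℝ) i • (q i - c)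
        = 0 := by
      have h1 : s • (coneSection c q n 0 - c) + t • (coneSection c q n 2 - c) =
          u • (coneSection c q n 1 - c) + v • (coneSection c q n 3 - c) := by
        have e1 : s • (coneSection c q n 0 - c) + t • (coneSection c q n 2 - c) =
          s • coneSection c q n 0 + t • coneSection c q n 2 - (s + t) • c := by module
        have e2 : u • (coneSection c q n 1 - c) + v • (coneSection c q n 3 - c) =
          u • coneSection c q n 1 + v • coneSection c q n 3 - (u + v) • c := by module
        rw [e1, e2, hst, huv, he]
      simp only [coneSection_sub, smul_smul] at h1
      rw [← sub_eq_zero] at h1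
      simp only [Fin.sum_univ_four, Matrix.cons_val]
      rw [← h1]
      module
    have h02 := mul_baseCoeff_comm h 0 2
    have h13 := mul_baseCoeff_comm h 1 3
    simp only [Matrix.cons_val] at h02 h13
    have := inv_pos.mpr (hn 0)
    have := inv_pos.mpr (hn 1)
    have := inv_pos.mpr (hn 2)
    have := inv_pos.mpr (hn 3)
    have key {a b x y : ℝ} (ha : 0 < a) (hb : 0 < b) (hx : x ≠ 0) (h : a * y = b * x) :
        0 < x * y := by
      have : a * (x * y) = b * x ^ 2 := by linear_combination x * h
      have : 0 < a * (x * y) := by rw [this]; positivity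
      exact pos_of_mul_pos_right this ha.le
    exact ⟨key (by positivity) (by positivity) (hne 0) h02,
      key (mul_pos hu (inv_pos.mpr (hn 1))) (mul_pos hv (inv_pos.mpr (hn 3))) (hne 1)
        (by linear_combination -h13)⟩
  · rintro ⟨h02, h13⟩
    have hne : ∀ i, baseCoeff c q i ≠ 0 := by
      have := left_ne_zero_of_mul h02.ne'
      have := right_ne_zero_of_mul h02.ne'
      have := left_ne_zero_of_mul h13.ne'
      have := right_ne_zero_of_mul h13.ne'
      intro i
      fin_cases i <;> assumption
    refine ⟨hne, ?_⟩
    have hsum := sum_baseCoeff_smul c q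
    have hin := sum_baseCoeff_mul_inner c q n
    simp only [Fin.sum_univ_four] at hsum hin
    have hd (i : Fin 4) : q i - c = (inner ℝ n (q i - c) : ℝ) • (coneSection c q n i - c) := by
      rw [coneSection_sub, smul_smul, mul_inv_cancel₀ (hn i).ne', one_smul]
    rw [hd 0, hd 1, hd 2, hd 3] at hsum
    generalize baseCoeff c q = a at *
    have p0 := hn 0
    have p1 := hn 1
    have p2 := hn 2
    have p3 := hn 3
    generalize (inner ℝ n (q 0 - c) : ℝ) = h0 at *
    generalize (inner ℝ n (q 1 - c) : ℝ) = h1 at *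
    generalize (inner ℝ n (q 2 - c) : ℝ) = h2 at *
    generalize (inner ℝ n (q 3 - c) : ℝ) = h3 at *
    have key {x y g h : ℝ} (hxy : 0 < x * y) (hg : 0 < g) (hh : 0 < h) :
        0 < x * g / (x * g + y * h) := by
      rcases mul_pos_iff.mp hxy with ⟨hx, hy⟩ | ⟨hx, hy⟩
      · positivity
      · exact div_pos_of_neg_of_neg (mul_neg_of_neg_of_pos hx hg)
          (add_neg (mul_neg_of_neg_of_pos hx hg) (mul_neg_of_neg_of_pos hy hh))
    have hS : a 0 * h0 + a 2 * h2 ≠ 0 := by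
      intro h
      have := key h02 p0 p2
      simp [h] at this
    -- The half-space condition forces the two diagonals to carry opposite total weight; dividing by
    -- these totals gives the two convex combinations.
    have hT : a 1 * h1 + a 3 * h3 = -(a 0 * h0 + a 2 * h2) := by linear_combination hin
    have hT' : a 1 * h1 + a 3 * h3 ≠ 0 := by rw [hT]; exact neg_ne_zero.mpr hS
    refine ⟨_, ⟨a 0 * h0 / (a 0 * h0 + a 2 * h2), a 2 * h2 / (a 2 * h2 + a 0 * h0),
      key h02 p0 p2, key (by rwa [mul_comm]) p2 p0, ?_, rfl⟩,
      ⟨a 1 * h1 / (a 1 * h1 + a 3 * h3), a 3 * h3 / (a 3 * h3 + a 1 * h1),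
      key h13 p1 p3, key (by rwa [mul_comm]) p3 p1, ?_, ?_⟩⟩
    · rw [add_comm (a 2 * h2), ← add_div, div_self hS]
    · rw [add_comm (a 3 * h3), ← add_div, div_self hT']
    · rw [add_comm (a 2 * h2), add_comm (a 3 * h3), hT, ← sub_eq_zero]
      have hsum' : (a 0 * h0) • coneSection c q n 0 + (a 1 * h1) • coneSection c q n 1 +
          (a 2 * h2) • coneSection c q n 2 + (a 3 * h3) • coneSection c q n 3 = 0 := by
        have e : (a 0 * h0) • coneSection c q n 0 + (a 1 * h1) • coneSection c q n 1 +
          (a 2 * h2) • coneSection c q n 2 + (a 3 * h3) • coneSection c q n 3 =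
          (a 0 * h0 + a 1 * h1 + a 2 * h2 + a 3 * h3) • c := by
          rw [← sub_eq_zero, ← hsum]; module
        rw [e, hin, zero_smul]
      calc _ = -(a 0 * h0 + a 2 * h2)⁻¹ • ((a 0 * h0) • coneSection c q n 0 +
            (a 1 * h1) • coneSection c q n 1 + (a 2 * h2) • coneSection c q n 2 +
            (a 3 * h3) • coneSection c q n 3) := by
            simp only [div_eq_mul_inv, inv_neg]
            module
        _ = 0 := by rw [hsum', smul_zero]

/-- One or three of the factors are negative, so one factor has the sign opposite to the other
three; it will mark the reflex vertex. -/
theorem exists_forall_mul_neg_of_prod_neg {a : Fin 4 → ℝ} (h : ∏ i, a i < 0) :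
    ∃ i : Fin 4, ∀ k : Fin 3, a (i.succAbove k) * a i < 0 := by
  rw [Fin.prod_univ_four] at h
  have h0 : a 0 ≠ 0 := by rintro e; simp [e] at h
  have h1 : a 1 ≠ 0 := by rintro e; simp [e] at h
  have h2 : a 2 ≠ 0 := by rintro e; simp [e] at h
  have h3 : a 3 ≠ 0 := by rintro e; simp [e] at h
  have h4 : a 0 * a 1 * a 2 * a 3 < 0 →
      (a 1 * a 0 < 0 ∧ a 2 * a 0 < 0 ∧ a 3 * a 0 < 0) ∨
      (a 0 * a 1 < 0 ∧ a 2 * a 1 < 0 ∧ a 3 * a 1 < 0) ∨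
      (a 0 * a 2 < 0 ∧ a 1 * a 2 < 0 ∧ a 3 * a 2 < 0) ∨
      (a 0 * a 3 < 0 ∧ a 1 * a 3 < 0 ∧ a 2 * a 3 < 0) := by
    rcases h0.lt_or_gt with h0 | h0 <;> rcases h1.lt_or_gt with h1 | h1 <;>
      rcases h2.lt_or_gt with h2 | h2 <;> rcases h3.lt_or_gt with h3 | h3 <;>
      simp [mul_neg_iff, mul_pos_iff, h0, h1, h2, h3, h0.not_gt, h1.not_gt, h2.not_gt, h3.not_gt]
  rcases h4 h with h | h | h | h
  · exact ⟨0, fun k => by fin_cases k; exacts [h.1, h.2.1, h.2.2]⟩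
  · exact ⟨1, fun k => by fin_cases k; exacts [h.1, h.2.1, h.2.2]⟩
  · exact ⟨2, fun k => by fin_cases k; exacts [h.1, h.2.1, h.2.2]⟩
  · exact ⟨3, fun k => by fin_cases k; exacts [h.1, h.2.1, h.2.2]⟩

theorem mem_convexHull_range_fin_three {x : Fin 3 → E3} {y : E3} :
    y ∈ convexHull ℝ (Set.range x) ↔
      ∃ w : Fin 3 → ℝ, (∀ k, 0 ≤ w k) ∧ ∑ k, w k = 1 ∧ ∑ k, w k • x k = y := by
  rw [convexHull_range_eq_exists_affineCombination]
  constructor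
  · rintro ⟨s, w, h0, h1, rfl⟩
    refine ⟨fun k => if k ∈ s then w k else 0, fun k => ?_, by simpa using h1, ?_⟩
    · dsimp only
      split_ifs with hk
      exacts [h0 k hk, le_rfl]
    · rw [Finset.affineCombination_eq_linear_combination _ _ _ h1]
      simp [ite_smul]
  · rintro ⟨w, h0, h1, rfl⟩
    exact ⟨Finset.univ, w, fun k _ => h0 k, h1,
      Finset.affineCombination_eq_linear_combination _ _ _ h1⟩

theorem isPseudoTriangleQuad_coneSection_iff {c : E3} {q : Fin 4 → E3} {n : E3}
    (hn : ∀ i, 0 < (inner ℝ n (q i - c) : ℝ)) :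
    IsPseudoTriangleQuad (coneSection c q n) ↔ ∏ i, baseCoeff c q i < 0 := by
  rw [IsPseudoTriangleQuad, noThreeCollinear_coneSection_iff hn]
  have himg (i : Fin 4) : coneSection c q n '' {i}ᶜ =
      Set.range fun k : Fin 3 => coneSection c q n (i.succAbove k) := by
    rw [Set.range_comp' (coneSection c q n) i.succAbove, Fin.range_succAbove]
  simp only [himg, mem_convexHull_range_fin_three]
  constructor
  · rintro ⟨hne, i, w, hw, hw1, hws⟩
    have h1 : ∑ k, w k • (coneSection c q n (i.succAbove k) - c) = coneSection c q n i - c := by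
      simp only [smul_sub, Finset.sum_sub_distrib, ← Finset.sum_smul, hw1, hws, one_smul]
    simp only [coneSection_sub, smul_smul] at h1
    have h2 : ∑ j, (i.insertNth (-(inner ℝ n (q i - c) : ℝ)⁻¹)
        (fun k => w k * (inner ℝ n (q (i.succAbove k) - c) : ℝ)⁻¹) : Fin 4 → ℝ) j • (q j - c)
        = 0 := by
      rw [Fin.sum_univ_succAbove _ i]
      simp [h1]
    have h3 (k : Fin 3) : baseCoeff c q (i.succAbove k) * baseCoeff c q i < 0 := by
      have := mul_baseCoeff_comm h2 (i.succAbove k) i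
      simp only [Fin.insertNth_apply_succAbove, Fin.insertNth_apply_same] at this
      have hp := inv_pos.mpr (hn i)
      have hp' := inv_pos.mpr (hn (i.succAbove k))
      have h4 : (inner ℝ n (q i - c) : ℝ)⁻¹ *
          (baseCoeff c q (i.succAbove k) * baseCoeff c q i) ≤ 0 := by
        have h5 : 0 ≤ w k * (inner ℝ n (q (i.succAbove k) - c) : ℝ)⁻¹ * baseCoeff c q i ^ 2 :=
          mul_nonneg (mul_nonneg (hw k) hp'.le) (sq_nonneg _)
        linear_combination h5 + baseCoeff c q i * this
      exact lt_of_le_of_ne (nonpos_of_mul_nonpos_right h4 hp) (mul_ne_zero (hne _) (hne _))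
    rw [Fin.prod_univ_succAbove _ i, Fin.prod_univ_three]
    have h4 := mul_pos_of_neg_of_neg (h3 0) (h3 1)
    have h5 := mul_neg_of_pos_of_neg h4 (h3 2)
    have h6 : 0 < baseCoeff c q i ^ 2 := by have := hne i; positivity
    refine neg_of_mul_neg_right (a := baseCoeff c q i ^ 2) ?_ h6.le
    linear_combination h5
  · intro h
    have hne : ∀ i, baseCoeff c q i ≠ 0 := fun i hi => by
      rw [Finset.prod_eq_zero (Finset.mem_univ i) hi] at h
      exact lt_irrefl _ h
    refine ⟨hne, ?_⟩
    obtain ⟨i, hi⟩ := exists_forall_mul_neg_of_prod_neg h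
    have hin := sum_baseCoeff_mul_inner c q n
    have hsum := sum_baseCoeff_smul c q
    rw [Fin.sum_univ_succAbove _ i] at hin hsum
    -- Barycentric coordinates of the reflex vertex, obtained by solving the height-scaled
    -- dependency for it.
    have hw1 : ∑ k, -(baseCoeff c q (i.succAbove k) * (inner ℝ n (q (i.succAbove k) - c) : ℝ) *
        (baseCoeff c q i * (inner ℝ n (q i - c) : ℝ))⁻¹) = 1 := by
      rw [Finset.sum_neg_distrib, ← Finset.sum_mul, eq_neg_of_add_eq_zero_right hin, neg_mul,
        neg_neg, mul_inv_cancel₀ (mul_ne_zero (hne i) (hn i).ne')]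
    refine ⟨i, _, fun k => ?_, hw1, ?_⟩
    · rw [neg_nonneg]
      have : baseCoeff c q (i.succAbove k) * (inner ℝ n (q (i.succAbove k) - c) : ℝ) *
        (baseCoeff c q i * (inner ℝ n (q i - c) : ℝ))⁻¹ =
        (baseCoeff c q (i.succAbove k) * baseCoeff c q i) *
          ((baseCoeff c q i ^ 2)⁻¹ * ((inner ℝ n (q (i.succAbove k) - c) : ℝ) *
            (inner ℝ n (q i - c) : ℝ)⁻¹)) := by
        have := hne i
        field_simp
      rw [this]
      exact mul_nonpos_of_nonpos_of_nonneg (hi k).le (mul_nonneg (inv_nonneg.mpr (sq_nonneg _))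
        (mul_nonneg (hn _).le (inv_nonneg.mpr (hn _).le)))
    · simp only [coneSection, smul_add, Finset.sum_add_distrib, ← Finset.sum_smul, hw1, one_smul,
        smul_smul]
      congr 1
      have h1 (k : Fin 3) : -(baseCoeff c q (i.succAbove k) *
          (inner ℝ n (q (i.succAbove k) - c) : ℝ) *
          (baseCoeff c q i * (inner ℝ n (q i - c) : ℝ))⁻¹) *
          (inner ℝ n (q (i.succAbove k) - c) : ℝ)⁻¹ =
          -(baseCoeff c q i * (inner ℝ n (q i - c) : ℝ))⁻¹ * baseCoeff c q (i.succAbove k) := by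
        have := (hn (i.succAbove k)).ne'
        field_simp
      simp only [h1, ← smul_smul, ← Finset.smul_sum]
      rw [eq_neg_of_add_eq_zero_right hsum, smul_neg, neg_smul, neg_neg, smul_smul, mul_inv,
        mul_right_comm, inv_mul_cancel₀ (hne i), one_mul]

/-! ### Sign criteria for roofs, and their openness. -/

theorem isConvexRoof_iff (x : Fin 5 → E3) : IsConvexRoof x ↔
    (∃ n : E3, ∀ i, 0 < (inner ℝ n (roofBase x i - x 4) : ℝ)) ∧
      0 < baseCoeff (x 4) (roofBase x) 0 * baseCoeff (x 4) (roofBase x) 2 ∧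
      0 < baseCoeff (x 4) (roofBase x) 1 * baseCoeff (x 4) (roofBase x) 3 := by
  rw [IsConvexRoof, ← exists_and_right]
  exact exists_congr fun n => and_congr_right fun hn => isStrictlyConvexQuad_coneSection_iff hn

theorem isPseudoTriangularRoof_iff (x : Fin 5 → E3) : IsPseudoTriangularRoof x ↔
    (∃ n : E3, ∀ i, 0 < (inner ℝ n (roofBase x i - x 4) : ℝ)) ∧
      ∏ i, baseCoeff (x 4) (roofBase x) i < 0 := by
  rw [IsPseudoTriangularRoof, ← exists_and_right]
  exact exists_congr fun n => and_congr_right fun hn => isPseudoTriangleQuad_coneSection_iff hn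

theorem continuous_roofBase (i : Fin 4) : Continuous fun x : Fin 5 → E3 => roofBase x i := by
  fin_cases i <;> simp [roofBase] <;> fun_prop

theorem continuous_baseCoeff_roofBase (i : Fin 4) :
    Continuous fun x : Fin 5 → E3 => baseCoeff (x 4) (roofBase x) i := by
  have := continuous_roofBase
  unfold baseCoeff
  refine continuous_const.mul (Continuous.matrix_det (continuous_matrix fun k l => ?_))
  simp only [Matrix.of_apply, PiLp.sub_apply]
  fun_prop

theorem isOpen_setOf_exists_forall_inner_pos :
    IsOpen {x : Fin 5 → E3 | ∃ n : E3, ∀ i, 0 < (inner ℝ n (roofBase x i - x 4) : ℝ)} := by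
  have := continuous_roofBase
  simp only [Set.ofPred_exists, Set.ofPred_forall]
  refine isOpen_iUnion fun n => isOpen_iInter_of_finite fun i => isOpen_lt continuous_const ?_
  fun_prop

theorem isOpen_setOf_isConvexRoof : IsOpen {x : Fin 5 → E3 | IsConvexRoof x} := by
  simp only [isConvexRoof_iff]
  have h := continuous_baseCoeff_roofBase
  exact isOpen_setOf_exists_forall_inner_pos.and
    ((isOpen_lt continuous_const ((h 0).mul (h 2))).and
      (isOpen_lt continuous_const ((h 1).mul (h 3))))

theorem isOpen_setOf_isPseudoTriangularRoof :
    IsOpen {x : Fin 5 → E3 | IsPseudoTriangularRoof x} := by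
  simp only [isPseudoTriangularRoof_iff]
  exact isOpen_setOf_exists_forall_inner_pos.and
    (isOpen_lt (continuous_finsetProd _ fun i _ => continuous_baseCoeff_roofBase i)
      continuous_const)

/-! ### Flexes of a single roof. -/

theorem inner_eq_sum_fin_three (x y : E3) : (inner ℝ x y : ℝ) = x 0 * y 0 + x 1 * y 1 + x 2 * y 2 := by
  simp [PiLp.inner_apply, Fin.sum_univ_three, mul_comm]

theorem roofGraph_adj (x y : Fin 5) : roofGraph.Adj x y ↔
    x ≠ y ∧ s(x, y) ≠ s(0, 1) ∧ s(x, y) ≠ s(2, 3) := by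
  simp [roofGraph]

/-- The equilibrium relation between the rates of change of the two hinges of a flexing roof. -/
theorem baseCoeff_mul_pairRate_add_eq_zero {x v : Fin 5 → E3}
    (hv : IsInfinitesimalMotion roofGraph x v) :
    baseCoeff (x 4) (roofBase x) 0 * baseCoeff (x 4) (roofBase x) 2 * pairRate x v 0 1 +
      baseCoeff (x 4) (roofBase x) 1 * baseCoeff (x 4) (roofBase x) 3 * pairRate x v 2 3 = 0 := by
  have hs := sum_baseCoeff_smul (x 4) (roofBase x)
  generalize baseCoeff (x 4) (roofBase x) = a at *
  have H (l : Fin 3) := congrArg (fun x : E3 => x l) hs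
  have H0 := H 0
  have H1 := H 1
  have H2 := H 2
  simp only [Fin.sum_univ_four, PiLp.add_apply, PiLp.smul_apply, smul_eq_mul, PiLp.zero_apply,
    roofBase, Matrix.cons_val, PiLp.sub_apply] at H0 H1 H2
  have E (i j : Fin 5) (h : i ≠ j ∧ s(i, j) ≠ s(0, 1) ∧ s(i, j) ≠ s(2, 3)) :=
    hv i j ((roofGraph_adj i j).mpr h)
  have e04 := E 0 4 (by decide)
  have e14 := E 1 4 (by decide)
  have e24 := E 2 4 (by decide)
  have e34 := E 3 4 (by decide)
  have e02 := E 0 2 (by decide)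
  have e03 := E 0 3 (by decide)
  have e12 := E 1 2 (by decide)
  have e13 := E 1 3 (by decide)
  simp only [pairRate, inner_eq_sum_fin_three, PiLp.sub_apply] at *
  -- The vanishing sum of the `a i • (q i - c)` is paired with the same combination of relative
  -- velocities. By polarization the mixed terms become rates of base pairs and apex edges, and all
  -- but the two hinge rates are zero.
  have W (l : Fin 3) : ∃ w, w = a 0 * (v 0 l - v 4 l) + a 1 * (v 2 l - v 4 l) +
    a 2 * (v 1 l - v 4 l) + a 3 * (v 3 l - v 4 l) := ⟨_, rfl⟩
  obtain ⟨w0, hw0⟩ := W 0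
  obtain ⟨w1, hw1⟩ := W 1
  obtain ⟨w2, hw2⟩ := W 2
  have F := congrArg₂ (· + ·) (congrArg₂ (· + ·) (congrArg (· * w0) H0) (congrArg (· * w1) H1))
    (congrArg (· * w2) H2)
  simp only [zero_mul, add_zero, hw0, hw1, hw2] at F
  linear_combination -F + a 0 * (a 0 + a 1 + a 2 + a 3) * e04 + a 2 * (a 0 + a 1 + a 2 + a 3) * e14 +
    a 1 * (a 0 + a 1 + a 2 + a 3) * e24 + a 3 * (a 0 + a 1 + a 2 + a 3) * e34
    - a 0 * a 1 * e02 - a 0 * a 3 * e03 - a 2 * a 1 * e12 - a 2 * a 3 * e13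

theorem neg_iff_of_pos_mul {a b : ℝ} (ha : 0 < a) : a * b < 0 ↔ b < 0 :=
  smul_neg_iff_of_pos_left ha

theorem IsConvexRoof.isExpansiveContractive {x : Fin 5 → E3} (hx : IsConvexRoof x) :
    IsExpansiveContractive x := by
  intro v hv
  obtain ⟨-, h1, h2⟩ := (isConvexRoof_iff x).mp hx
  have h := baseCoeff_mul_pairRate_add_eq_zero hv
  have h' := eq_neg_of_add_eq_zero_left h
  have hp := mul_pos_iff_of_pos_left (b := pairRate x v 0 1) h1
  have hm := neg_iff_of_pos_mul (b := pairRate x v 0 1) h1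
  rw [h'] at hp hm
  rw [← hp, ← hm, neg_pos, neg_lt_zero, mul_pos_iff_of_pos_left h2, neg_iff_of_pos_mul h2]
  exact ⟨Iff.rfl, Iff.rfl⟩

theorem IsPseudoTriangularRoof.isExpansiveExpansive {x : Fin 5 → E3}
    (hx : IsPseudoTriangularRoof x) : IsExpansiveExpansive x := by
  intro v hv
  obtain ⟨-, h1⟩ := (isPseudoTriangularRoof_iff x).mp hx
  have h := baseCoeff_mul_pairRate_add_eq_zero hv
  rw [Fin.prod_univ_four] at h1
  generalize baseCoeff (x 4) (roofBase x) = a at *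
  have h2 : (a 0 * a 2) * (a 1 * a 3) < 0 := by linarith
  generalize a 0 * a 2 = s at *
  generalize a 1 * a 3 = t at *
  generalize pairRate x v 0 1 = r at *
  generalize pairRate x v 2 3 = r' at *
  rcases mul_neg_iff.mp h2 with ⟨hs, ht⟩ | ⟨hs, ht⟩
  · rw [← mul_pos_iff_of_pos_left hs, ← neg_iff_of_pos_mul hs, eq_neg_of_add_eq_zero_left h,
      ← neg_mul, mul_pos_iff_of_pos_left (neg_pos.mpr ht), neg_iff_of_pos_mul (neg_pos.mpr ht)]
    simp
  · have h' : t * r' = -s * r := by linear_combination h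
    rw [← mul_pos_iff_of_pos_left (b := r') ht, ← neg_iff_of_pos_mul (b := r') ht, h',
      mul_pos_iff_of_pos_left (neg_pos.mpr hs), neg_iff_of_pos_mul (neg_pos.mpr hs)]
    simp

/-! ### Implied pairs, rank and generic frameworks. -/

section Rigidity

variable {V : Type*} [DecidableEq V]

theorem sum_rigidityRow_mul [Fintype V] (p v : V → E3) (u w : V) :
    ∑ x, rigidityRow p u w x * v x.1 x.2 = pairRate p v u w := by
  simp only [rigidityRow, pairRate, add_mul, ite_mul, zero_mul, Finset.sum_add_distrib,
    Fintype.sum_prod_type_right, Finset.sum_ite_eq', Finset.mem_univ, if_true,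
    Fin.sum_univ_three, inner_eq_sum_fin_three, PiLp.sub_apply]
  ring

theorem range_row_rigidityMatrix (G : SimpleGraph V) (p : V → E3) :
    Set.range (rigidityMatrix G p).row = {r | ∃ u w, G.Adj u w ∧ rigidityRow p u w = r} := by
  ext r
  constructor
  · rintro ⟨⟨e, he⟩, rfl⟩
    induction e with
    | _ u w => exact ⟨u, w, he, rfl⟩
  · rintro ⟨u, w, h, rfl⟩
    exact ⟨⟨s(u, w), h⟩, rfl⟩

/-- A pair that no infinitesimal motion flexes is implied. -/
theorem isImpliedAt_of_forall_pairRate_eq_zero [Fintype V] {G : SimpleGraph V} {p : V → E3}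
    {u w : V} (h : ∀ v, IsInfinitesimalMotion G p v → pairRate p v u w = 0) :
    IsImpliedAt G p u w := by
  rw [IsImpliedAt, ← Subspace.forall_mem_dualAnnihilator_apply_eq_zero_iff]
  intro φ hφ
  rw [Submodule.mem_dualAnnihilator] at hφ
  -- A functional on rows is a velocity assignment; it kills all edge rows exactly when that
  -- assignment is an infinitesimal motion.
  have key (a b : V) : φ (rigidityRow p a b) =
      pairRate p (fun u => WithLp.toLp 2 fun l => φ (Pi.single (u, l) 1)) a b := by
    rw [LinearMap.pi_apply_eq_sum_univ φ, ← sum_rigidityRow_mul]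
    refine Finset.sum_congr rfl fun x _ => ?_
    rw [smul_eq_mul]
    congr 2
    ext y
    simp [Pi.single_apply, eq_comm]
  rw [key]
  refine h _ fun a b hab => ?_
  rw [← key]
  refine hφ _ (Submodule.subset_span ?_)
  rw [range_row_rigidityMatrix]
  exact ⟨a, b, hab, rfl⟩

open Polynomial in
/-- On the line through two matrices, the rank at the second one is a lower bound of the rank at all
but finitely many points. -/
theorem exists_polynomial_rank_le_of_eval_ne_zero {m n : Type*} [Finite m] [Fintype n]
    (A B : Matrix m n ℝ) :
    ∃ P : ℝ[X], P ≠ 0 ∧ ∀ t, P.eval t ≠ 0 → B.rank ≤ (A + t • (B - A)).rank := by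
  classical
  obtain ⟨κ, a, ha, hspan, hli⟩ := exists_linearIndependent' ℝ B.row
  have := Finite.of_injective a ha
  have := Fintype.ofFinite κ
  have hrank : B.rank = Fintype.card κ := by
    rw [Matrix.rank_eq_finrank_span_row, ← hspan, finrank_span_eq_card hli]
  -- The rows indexed by `κ` form a basis of the row space of `B`. Their Gram determinant along the
  -- line is a polynomial in `t`, nonzero at `t = 1`, and where it is nonzero the rows remain
  -- independent.
  let N : Matrix κ n ℝ[X] :=
    Matrix.of fun i j => C (A (a i) j) + X * C ((B - A) (a i) j)
  have hN (t : ℝ) : N.map (evalRingHom t) = (A + t • (B - A)).submatrix a id := by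
    ext i j
    simp [N]
  have hdet (t : ℝ) : (N * N.transpose).det.eval t =
      ((A + t • (B - A)).submatrix a id * ((A + t • (B - A)).submatrix a id).transpose).det := by
    rw [← hN, ← coe_evalRingHom, RingHom.map_det, RingHom.mapMatrix_apply, Matrix.map_mul,
      Matrix.transpose_map]
  refine ⟨(N * N.transpose).det, fun h0 => ?_, fun t ht => ?_⟩
  · have h1 := hdet 1
    rw [h0, eval_zero, one_smul, add_sub_cancel] at h1
    obtain ⟨w, hw, hw0⟩ := Matrix.exists_vecMul_eq_zero_iff.mpr h1.symm
    rw [← Matrix.conjTranspose_eq_transpose_of_trivial,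
      Matrix.vecMul_self_mul_conjTranspose_eq_zero] at hw0
    apply hw
    funext i
    refine Fintype.linearIndependent_iff.mp hli w ?_ i
    funext j
    simp only [Finset.sum_apply, Pi.smul_apply, smul_eq_mul]
    exact congrFun hw0 j
  · rw [hdet] at ht
    rw [hrank, ← Matrix.rank_of_det_ne_zero ht, Matrix.rank_self_mul_transpose]
    exact Matrix.rank_submatrix_le _ _ _

theorem rigidityMatrix_add_smul (G : SimpleGraph V) (p q : V → E3) (t : ℝ) :
    rigidityMatrix G (p + t • (q - p)) =
      rigidityMatrix G p + t • (rigidityMatrix G q - rigidityMatrix G p) := by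
  ext ⟨e, he⟩ x
  induction e with
  | _ u w =>
    change rigidityRow _ u w x = rigidityRow p u w x + t * (rigidityRow q u w x - rigidityRow p u w x)
    simp only [rigidityRow, Pi.add_apply, Pi.smul_apply, Pi.sub_apply, PiLp.add_apply,
      PiLp.smul_apply, PiLp.sub_apply, smul_eq_mul]
    split_ifs <;> ring

theorem exists_isGenericFramework [Fintype V] (G : SimpleGraph V) :
    ∃ q : V → E3, IsGenericFramework G q := by
  have hfin : (Set.range fun q : V → E3 => (rigidityMatrix G q).rank).Finite :=
    (Set.finite_Iic (Fintype.card (V × Fin 3))).subset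
      (by rintro _ ⟨q, rfl⟩; exact Matrix.rank_le_card_width _)
  obtain ⟨_, -, ⟨q, rfl⟩, hq⟩ := hfin.exists_le_maximal (Set.mem_range_self 0)
  exact ⟨q, fun q' => (le_total _ _).elim id (hq (Set.mem_range_self q'))⟩

/-- Generic frameworks are dense. -/
theorem IsOpen.exists_isGenericFramework [Fintype V] (G : SimpleGraph V) {U : Set (V → E3)}
    (hU : IsOpen U) (hne : U.Nonempty) : ∃ p ∈ U, IsGenericFramework G p := by
  obtain ⟨p, hp⟩ := hne
  obtain ⟨q, hq⟩ := _root_.exists_isGenericFramework G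
  obtain ⟨P, hP, hrank⟩ :=
    exists_polynomial_rank_le_of_eval_ne_zero (rigidityMatrix G p) (rigidityMatrix G q)
  have hcont : Continuous fun t : ℝ => p + t • (q - p) := by fun_prop
  have hinf : ((fun t : ℝ => p + t • (q - p)) ⁻¹' U).Infinite :=
    infinite_of_mem_nhds 0 ((hU.preimage hcont).mem_nhds (by simpa using hp))
  obtain ⟨t, htU, ht⟩ := hinf.exists_notMem_finset P.roots.toFinset
  refine ⟨_, htU, fun q' => (hq q').trans ?_⟩
  rw [rigidityMatrix_add_smul]
  exact hrank t fun h => ht (by simp [hP, h])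

theorem span_row_mono {G G' : SimpleGraph V} (h : G ≤ G') (p : V → E3) :
    Submodule.span ℝ (Set.range (rigidityMatrix G p).row) ≤
      Submodule.span ℝ (Set.range (rigidityMatrix G' p).row) := by
  simp only [range_row_rigidityMatrix]
  refine Submodule.span_mono ?_
  rintro r ⟨u, w, hadj, rfl⟩
  exact ⟨u, w, h hadj, rfl⟩

/-- A pair that is implied in an open set of frameworks is implied in all generic ones. -/
theorem isImpliedAt_of_isOpen [Fintype V] {G : SimpleGraph V} {u w : V} (huw : u ≠ w)
    {U : Set (V → E3)} (hU : IsOpen U) (hne : U.Nonempty)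
    (h : ∀ p ∈ U, IsImpliedAt G p u w) {p : V → E3} (hp : IsGenericFramework G p) :
    IsImpliedAt G p u w := by
  -- At a `G'`-generic `q` in `U` the added row costs no rank. So at a `G`-generic `p` the rank for
  -- `G'` is at most that for `G`, and the two row spaces coincide.
  let G' := G ⊔ SimpleGraph.edge u w
  obtain ⟨q, hqU, hq⟩ := hU.exists_isGenericFramework G' hne
  have hle : G ≤ G' := le_sup_left
  have hq' : (rigidityMatrix G' q).rank ≤ (rigidityMatrix G q).rank := by
    rw [Matrix.rank_eq_finrank_span_row, Matrix.rank_eq_finrank_span_row]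
    refine Submodule.finrank_mono (Submodule.span_le.mpr ?_)
    rw [range_row_rigidityMatrix G']
    rintro r ⟨a, b, hab, rfl⟩
    rcases hab with hab | hab
    · refine Submodule.subset_span ?_
      rw [range_row_rigidityMatrix]
      exact ⟨a, b, hab, rfl⟩
    · rcases (SimpleGraph.edge_adj u w a b).mp hab with ⟨⟨rfl, rfl⟩ | ⟨rfl, rfl⟩, -⟩
      · exact h q hqU
      · rw [rigidityRow_comm]
        exact h q hqU
  have hr : (rigidityMatrix G' p).rank ≤ (rigidityMatrix G p).rank :=
    (hq p).trans (hq'.trans (hp q))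
  rw [Matrix.rank_eq_finrank_span_row, Matrix.rank_eq_finrank_span_row] at hr
  rw [IsImpliedAt, Submodule.eq_of_le_of_finrank_le (span_row_mono hle p) hr]
  refine Submodule.subset_span ?_
  rw [range_row_rigidityMatrix]
  exact ⟨u, w, Or.inr ((SimpleGraph.edge_adj u w u w).mpr ⟨Or.inl ⟨rfl, rfl⟩, huw⟩), rfl⟩

end Rigidity

/-! ### Propagating signs around the ring. -/

theorem IsInfinitesimalMotion.comp_roofVertex {k : ℕ} {p v : RingVertex k → E3}
    (hv : IsInfinitesimalMotion (ringGraph k) p v) (i : Fin k) :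
    IsInfinitesimalMotion roofGraph (p ∘ roofVertex i) (v ∘ roofVertex i) := by
  intro x y hxy
  -- For `k = 1` the two hinges of the roof coincide, so adjacent roof vertices can have the same
  -- image.
  by_cases h : roofVertex i x = roofVertex i y
  · simp [pairRate, h]
  · exact hv _ _ ((SimpleGraph.fromRel_adj _ _ _).mpr ⟨h, Or.inl ⟨i, x, y, hxy, rfl, rfl⟩⟩)

theorem finRotate_ne_self {k : ℕ} (hk : 2 ≤ k) (i : Fin k) : finRotate k i ≠ i := by
  obtain ⟨k, rfl⟩ := Nat.exists_eq_add_of_le' hk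
  rw [finRotate_apply]
  simp

theorem forall_fin_of_forall_finRotate_iff {k : ℕ} {P : Fin k → Prop}
    (h : ∀ i, P (finRotate k i) ↔ P i) {i : Fin k} (hi : P i) (l : Fin k) : P l := by
  cases k with
  | zero => exact i.elim0
  | succ k =>
    have h0 (l : Fin (k + 1)) : P l ↔ P 0 := by
      induction l using Fin.induction with
      | zero => rfl
      | succ l ih => rw [← ih, ← h l.castSucc, finRotate_apply, Fin.coeSucc_eq_succ]
    exact (h0 l).mpr ((h0 i).mp hi)

theorem pairRate_hinge_eq_zero {k : ℕ} {j : Fin k} {p : RingVertex k → E3}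
    (hp : IsOneConvexRing j p) {v : RingVertex k → E3}
    (hv : IsInfinitesimalMotion (ringGraph k) p v) (i : Fin k) :
    pairRate p v (hingeA i) (hingeB i) = 0 := by
  let r (i : Fin k) : ℝ := pairRate p v (hingeA i) (hingeB i)
  have hj : SignType.sign (r (finRotate k j)) = -SignType.sign (r j) := by
    obtain ⟨h1, h2⟩ := hp.1.isExpansiveContractive _ (hv.comp_roofVertex j)
    change (0 < r j ↔ r (finRotate k j) < 0) at h1
    change (r j < 0 ↔ 0 < r (finRotate k j)) at h2
    rcases lt_trichotomy (r j) 0 with h | h | h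
    · rw [sign_neg h, sign_pos (h2.mp h), neg_neg]
    · rw [h, sign_zero, neg_zero, sign_eq_zero_iff]
      rw [h] at h1 h2
      exact le_antisymm (not_lt.mp fun h => lt_irrefl _ (h2.mpr h))
        (not_lt.mp fun h => lt_irrefl _ (h1.mpr h))
    · rw [sign_pos h, sign_neg (h1.mp h)]
  have hi (i : Fin k) (hij : i ≠ j) :
      SignType.sign (r (finRotate k i)) = SignType.sign (r i) := by
    obtain ⟨h1, h2⟩ := (hp.2 i hij).isExpansiveExpansive _ (hv.comp_roofVertex i)
    change (0 < r i ↔ 0 < r (finRotate k i)) at h1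
    change (r i < 0 ↔ r (finRotate k i) < 0) at h2
    rcases lt_trichotomy (r i) 0 with h | h | h
    · rw [sign_neg h, sign_neg (h2.mp h)]
    · rw [h, sign_zero, sign_eq_zero_iff]
      rw [h] at h1 h2
      exact le_antisymm (not_lt.mp fun h => lt_irrefl _ (h1.mpr h))
        (not_lt.mp fun h => lt_irrefl _ (h2.mpr h))
    · rw [sign_pos h, sign_pos (h1.mp h)]
  -- Reindexing by the rotation leaves the product unchanged, while the single convex roof
  -- contributes a factor `-1`.
  have hprod : ∏ i, SignType.sign (r i) = -∏ i, SignType.sign (r i) := by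
    conv_lhs => rw [← Equiv.prod_comp (finRotate k)]
    rw [← Finset.mul_prod_erase _ _ (Finset.mem_univ j), hj,
      Finset.prod_congr rfl fun i h => hi i (Finset.ne_of_mem_erase h), neg_mul,
      Finset.mul_prod_erase _ (fun i => SignType.sign (r i)) (Finset.mem_univ j)]
  have hzero : ∏ i, SignType.sign (r i) = 0 := by
    revert hprod
    generalize ∏ i, SignType.sign (r i) = s
    revert s
    decide
  obtain ⟨l, -, hl⟩ := Finset.prod_eq_zero_iff.mp hzero
  refine sign_eq_zero_iff.mp
    (forall_fin_of_forall_finRotate_iff (P := fun i => SignType.sign (r i) = 0) (fun i => ?_) hl i)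
  by_cases hij : i = j
  · rw [hij, hj]
    generalize SignType.sign (r j) = s
    revert s
    decide
  · rw [hi i hij]

theorem isOpen_setOf_isOneConvexRing {k : ℕ} (j : Fin k) :
    IsOpen {p : RingVertex k → E3 | IsOneConvexRing j p} := by
  have hc (i : Fin k) : Continuous fun p : RingVertex k → E3 => p ∘ roofVertex i := by fun_prop
  have h : {p : RingVertex k → E3 | IsOneConvexRing j p} =
      {p | IsConvexRoof (p ∘ roofVertex j)} ∩
        ⋂ i : Fin k, {p | i ≠ j → IsPseudoTriangularRoof (p ∘ roofVertex i)} := by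
    ext p
    simp [IsOneConvexRing]
  rw [h]
  refine (isOpen_setOf_isConvexRoof.preimage (hc j)).inter (isOpen_iInter_of_finite fun i => ?_)
  by_cases hij : i = j
  · simp [hij]
  · simpa [hij] using isOpen_setOf_isPseudoTriangularRoof.preimage (hc i)

/-- Roof edges avoiding the apex join two different hinges as long as the rotation has no fixed
point. -/
theorem not_ringGraph_adj_hinge {k : ℕ} (hk : 2 ≤ k) (i : Fin k) :
    ¬ (ringGraph k).Adj (hingeA i) (hingeB i) := by
  have key (l : Fin k) (x y : Fin 5) (hxy : roofGraph.Adj x y) (hx : roofVertex l x = hingeA i)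
      (hy : roofVertex l y = hingeB i) : False := by
    have hne := finRotate_ne_self hk l
    rw [roofGraph_adj] at hxy
    fin_cases x <;> fin_cases y <;>
      simp [roofVertex, hingeA, hingeB, roofApex, -finRotate_apply] at hx hy hxy <;>
      first
        | exact hne (hx.trans hy.symm)
        | exact hne (hy.trans hx.symm)
  rw [ringGraph, SimpleGraph.fromRel_adj]
  rintro ⟨-, ⟨l, x, y, h, hx, hy⟩ | ⟨l, x, y, h, hx, hy⟩⟩
  · exact key l x y h hx hy
  · exact key l y x h.symm hy hx

/-! ### Construction of a ring with one convex roof. -/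

/-- Six times the signed volume of the tetrahedron spanned by the base of a roof. -/
noncomputable def baseVolume (x : Fin 5 → E3) : ℝ :=
  (Matrix.of fun k l : Fin 3 => (![x 1 - x 0, x 2 - x 0, x 3 - x 0] k) l).det

/-- Writing the apex as an affine combination of the base prescribes the dependency: here the
weights are `1, 1` on one hinge and `-1/2, -1/2` on the other. -/
theorem isConvexRoof_of_apex {x : Fin 5 → E3} (h : baseVolume x ≠ 0)
    (hx : x 4 = x 0 + x 1 - (1 / 2 : ℝ) • (x 2 + x 3)) : IsConvexRoof x := by
  have hx' (l : Fin 3) : x 4 l = x 0 l + x 1 l - 1 / 2 * (x 2 l + x 3 l) := by simp [hx, mul_add]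
  have hD : 0 < baseVolume x ^ 2 := by positivity
  obtain ⟨D, hD'⟩ : ∃ D, D = baseVolume x := ⟨_, rfl⟩
  have hDe := hD'
  simp only [baseVolume, Matrix.det_fin_three, Matrix.of_apply, Matrix.cons_val, PiLp.sub_apply]
    at hDe
  rw [← hD'] at hD
  rw [isConvexRoof_iff]
  -- The normal is the cross product of the two hinge directions, constant along each hinge; the
  -- factor `D` makes the heights positive multiples of `D ^ 2` for either orientation.
  refine ⟨⟨!₂[D * (((x 3 1 - x 2 1) * (x 1 2 - x 0 2) - (x 3 2 - x 2 2) * (x 1 1 - x 0 1))),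
    D * (((x 3 2 - x 2 2) * (x 1 0 - x 0 0) - (x 3 0 - x 2 0) * (x 1 2 - x 0 2))),
    D * (((x 3 0 - x 2 0) * (x 1 1 - x 0 1) - (x 3 1 - x 2 1) * (x 1 0 - x 0 0)))],
    fun i => ?_⟩, ?_, ?_⟩
  · rw [inner_eq_sum_fin_three]
    have h2 : 0 < 2 * D ^ 2 := by positivity
    fin_cases i <;> simp [roofBase, hx', -mul_pos_iff_of_pos_left]
    · refine hD.trans_eq ?_
      rw [pow_two]; nth_rewrite 2 [hDe]; ring
    · refine h2.trans_eq ?_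
      rw [pow_two]; nth_rewrite 2 [hDe]; ring
    · refine hD.trans_eq ?_
      rw [pow_two]; nth_rewrite 2 [hDe]; ring
    · refine h2.trans_eq ?_
      rw [pow_two]; nth_rewrite 2 [hDe]; ring
  · rw [baseCoeff_zero, baseCoeff_two]
    simp only [Matrix.det_fin_three, Matrix.of_apply, Matrix.cons_val, PiLp.sub_apply, hx',
      roofBase]
    refine hD.trans_eq ?_
    rw [hDe]
    ring
  · rw [baseCoeff_one, baseCoeff_three]
    simp only [Matrix.det_fin_three, Matrix.of_apply, Matrix.cons_val, PiLp.sub_apply, hx',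
      roofBase]
    refine (half_pos (half_pos hD)).trans_eq ?_
    rw [hDe]
    ring

/-- The weights `1, 1, 1, -2` have one odd sign, which makes `x 3` project to the reflex vertex. -/
theorem isPseudoTriangularRoof_of_apex {x : Fin 5 → E3} (h : baseVolume x ≠ 0)
    (hx : x 4 = x 0 + x 1 + x 2 - (2 : ℝ) • x 3) : IsPseudoTriangularRoof x := by
  have hx' (l : Fin 3) : x 4 l = x 0 l + x 1 l + x 2 l - 2 * x 3 l := by simp [hx]
  have hD : 0 < baseVolume x ^ 2 := by positivity
  obtain ⟨D, hD'⟩ : ∃ D, D = baseVolume x := ⟨_, rfl⟩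
  have hDe := hD'
  simp only [baseVolume, Matrix.det_fin_three, Matrix.of_apply, Matrix.cons_val, PiLp.sub_apply]
    at hDe
  rw [← hD'] at hD
  rw [isPseudoTriangularRoof_iff]
  -- The normal of the plane through `x 0`, `x 1`, `x 2`, oriented by `D`.
  refine ⟨⟨!₂[D * ((x 1 1 - x 0 1) * (x 2 2 - x 0 2) - (x 1 2 - x 0 2) * (x 2 1 - x 0 1)),
    D * ((x 1 2 - x 0 2) * (x 2 0 - x 0 0) - (x 1 0 - x 0 0) * (x 2 2 - x 0 2)),
    D * ((x 1 0 - x 0 0) * (x 2 1 - x 0 1) - (x 1 1 - x 0 1) * (x 2 0 - x 0 0))],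
    fun i => ?_⟩, ?_⟩
  · rw [inner_eq_sum_fin_three]
    have h2 : 0 < 2 * D ^ 2 := by positivity
    have h3 : 0 < 3 * D ^ 2 := by positivity
    fin_cases i <;> simp [roofBase, hx', -mul_pos_iff_of_pos_left]
    · refine h2.trans_eq ?_
      rw [pow_two]; nth_rewrite 2 [hDe]; ring
    · refine h2.trans_eq ?_
      rw [pow_two]; nth_rewrite 2 [hDe]; ring
    · refine h2.trans_eq ?_
      rw [pow_two]; nth_rewrite 2 [hDe]; ring
    · refine h3.trans_eq ?_
      rw [pow_two]; nth_rewrite 2 [hDe]; ring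
  · have e0 : baseCoeff (x 4) (roofBase x) 0 = -D := by
      rw [baseCoeff_zero, hDe]
      simp only [Matrix.det_fin_three, Matrix.of_apply, Matrix.cons_val, PiLp.sub_apply, hx',
        roofBase]
      ring
    have e1 : baseCoeff (x 4) (roofBase x) 1 = -D := by
      rw [baseCoeff_one, hDe]
      simp only [Matrix.det_fin_three, Matrix.of_apply, Matrix.cons_val, PiLp.sub_apply, hx',
        roofBase]
      ring
    have e2 : baseCoeff (x 4) (roofBase x) 2 = -D := by
      rw [baseCoeff_two, hDe]
      simp only [Matrix.det_fin_three, Matrix.of_apply, Matrix.cons_val, PiLp.sub_apply, hx',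
        roofBase]
      ring
    have e3 : baseCoeff (x 4) (roofBase x) 3 = 2 * D := by
      rw [baseCoeff_three, hDe]
      simp only [Matrix.det_fin_three, Matrix.of_apply, Matrix.cons_val, PiLp.sub_apply, hx',
        roofBase]
      ring
    rw [Fin.prod_univ_four, e0, e1, e2, e3]
    have : 0 < 2 * (D ^ 2) ^ 2 := by positivity
    linarith

/-- The moment curve in space. -/
noncomputable def momentCurve (t : ℝ) : E3 := !₂[t, t ^ 2, t ^ 3]

/-- A Vandermonde determinant: distinct points of the moment curve are never coplanar in fours. -/
theorem baseVolume_momentCurve (a b c d : ℝ) (y : E3) :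
    baseVolume ![momentCurve a, momentCurve b, momentCurve c, momentCurve d, y] =
      (b - a) * (c - a) * (d - a) * (c - b) * (d - b) * (d - c) := by
  simp only [baseVolume, momentCurve, Matrix.det_fin_three, Matrix.of_apply, Matrix.cons_val,
    PiLp.sub_apply]
  ring

theorem baseVolume_momentCurve_ne_zero {i l : ℕ} (h : l ≠ i) (y : E3) :
    baseVolume ![momentCurve (2 * i), momentCurve (2 * i + 1), momentCurve (2 * l),
      momentCurve (2 * l + 1), y] ≠ 0 := by
  rw [baseVolume_momentCurve]
  have h1 : (2 * l : ℝ) - 2 * i ≠ 0 := sub_ne_zero.mpr (by norm_cast; omega)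
  have h2 : (2 * l + 1 : ℝ) - 2 * i ≠ 0 := sub_ne_zero.mpr (by norm_cast; omega)
  have h3 : (2 * l : ℝ) - (2 * i + 1) ≠ 0 := sub_ne_zero.mpr (by norm_cast; omega)
  have h4 : (2 * l + 1 : ℝ) - (2 * i + 1) ≠ 0 := sub_ne_zero.mpr (by norm_cast; omega)
  simp only [add_sub_cancel_left, one_mul, mul_one]
  exact mul_ne_zero (mul_ne_zero (mul_ne_zero h1 h2) h3) h4

/-- Each apex belongs to a single roof, so after placing the hinges with every base non-coplanar the
apexes can be chosen independently. -/
theorem exists_isOneConvexRing {k : ℕ} (hk : 2 ≤ k) (j : Fin k) :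
    ∃ p : RingVertex k → E3, IsOneConvexRing j p := by
  let a (i : Fin k) : E3 := momentCurve (2 * (i : ℕ))
  let b (i : Fin k) : E3 := momentCurve (2 * (i : ℕ) + 1)
  let c (i : Fin k) : E3 :=
    if i = j then a i + b i - (1 / 2 : ℝ) • (a (finRotate k i) + b (finRotate k i))
    else a i + b i + a (finRotate k i) - (2 : ℝ) • b (finRotate k i)
  let p : RingVertex k → E3 := fun v => ![a v.1, b v.1, c v.1] v.2
  have hp (i : Fin k) :
      p ∘ roofVertex i = ![a i, b i, a (finRotate k i), b (finRotate k i), c i] := by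
    funext x
    fin_cases x <;> rfl
  have hvol (i : Fin k) : baseVolume (p ∘ roofVertex i) ≠ 0 := by
    rw [hp]
    exact baseVolume_momentCurve_ne_zero (Fin.val_ne_of_ne (finRotate_ne_self hk i)) _
  refine ⟨p, isConvexRoof_of_apex (hvol j) ?_, fun i hi =>
    isPseudoTriangularRoof_of_apex (hvol i) ?_⟩
  · rw [hp]
    simp [c]
  · rw [hp]
    simp [c, hi]

theorem lemma2p1 (k : ℕ) (hk : 7 ≤ k) :
    -- convex and pointed pseudo-triangular roofs have the stated flex signs
    ((∀ x : Fin 5 → E3, IsConvexRoof x → IsExpansiveContractive x) ∧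
      (∀ x : Fin 5 → E3, IsPseudoTriangularRoof x → IsExpansiveExpansive x)) ∧
    -- in every such ring framework no hinge non-edge flexes, and each is implied
    (∀ (j : Fin k) (p : RingVertex k → E3), IsOneConvexRing j p → ∀ i : Fin k,
      (∀ v : RingVertex k → E3, IsInfinitesimalMotion (ringGraph k) p v →
        pairRate p v (hingeA i) (hingeB i) = 0) ∧
      IsImpliedAt (ringGraph k) p (hingeA i) (hingeB i)) ∧
    -- such ring frameworks form an open set, which contains generic ones
    (∀ j : Fin k, IsOpen {p : RingVertex k → E3 | IsOneConvexRing j p} ∧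
      ∃ p : RingVertex k → E3, IsOneConvexRing j p ∧ IsGenericFramework (ringGraph k) p) ∧
    -- the hinge non-edges are implied non-edges of the ring of roofs
    (∀ i : Fin k, IsImpliedNonEdge (ringGraph k) (hingeA i) (hingeB i)) := by
  have hk2 : 2 ≤ k := by omega
  have himp (j : Fin k) (p : RingVertex k → E3) (hp : IsOneConvexRing j p) (i : Fin k) :
      IsImpliedAt (ringGraph k) p (hingeA i) (hingeB i) :=
    isImpliedAt_of_forall_pairRate_eq_zero fun v hv => pairRate_hinge_eq_zero hp hv i
  refine ⟨⟨fun x hx => hx.isExpansiveContractive, fun x hx => hx.isExpansiveExpansive⟩,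
    fun j p hp i => ⟨fun v hv => pairRate_hinge_eq_zero hp hv i, himp j p hp i⟩,
    fun j => ⟨isOpen_setOf_isOneConvexRing j, ?_⟩, fun i => ?_⟩
  · exact (isOpen_setOf_isOneConvexRing j).exists_isGenericFramework _
      (exists_isOneConvexRing hk2 j)
  · have hne : hingeA i ≠ hingeB i := by simp [hingeA, hingeB]
    exact ⟨hne, not_ringGraph_adj_hinge hk2 i, fun p hp =>
      isImpliedAt_of_isOpen hne (isOpen_setOf_isOneConvexRing i) (exists_isOneConvexRing hk2 i)
        (fun q hq => himp i q hq i) hp⟩
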